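/- Let $k$ be a field and let $S=k[x_1,\dots,x_n]$ be the polynomial ring with its standard grading. For a homogeneous ideal $I\subset S$ and integers $d\ge 0$, $p\ge 1$, say that $I$ satisfies $N_{d,p}$ if, for all $0\le s\le p-1$, the graded vector space $\operatorname{Tor}^S_s(I,k)$ is concentrated in degree $d+s$, that is, $\operatorname{Tor}^S_s(I,k)_e\ne 0$ implies $e=d+s$ (the case $\operatorname{Tor}^S_s(I,k)=0$ is allowed). Thus $N_{d,1}$ means that $I$ is generated in degree $d$, and $N_{d,2}$ means that moreover $I$ is linearly presented. Let $I\subset S$ be a monomial ideal generated in degree $d$, and let $f\notin I$ be a monomial of degree $d$. The transition $I\mapsto (I,f)$ is called a shelling move if the ideal $I:f$ is generated by a (possibly empty) subset of the variables $x_1,\dots,x_n$. Then: 1. If $(I,f)$ satisfies $N_{d,2}$, then $I\mapsto (I,f)$ is a shelling move. 2. If $I$ satisfies $N_{d,2}$, then $I\mapsto (I,f)$ is a shelling move if and only if $(I,f)$ satisfies $N_{d,2}$. 3. If $I$ satisfies $N_{d,p}$ for some $p\ge 2$ and $I\mapsto (I,f)$ is a shelling move, then $(I,f)$ satisfies $N_{d,p}$.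 -/

import Mathlib

open MvPolynomial

noncomputable section

/-- A graded free resolution by finitely generated free modules
`⋯ → F₂ → F₁ → F₀ → I → 0` of an ideal `I` of the standard graded polynomial ring
`S = k[x₁, …, xₙ]`. Here `F_s = ⊕_{j ∈ ι s} S(-deg s j)` is the module of column vectors
`ι s → S` whose `j`-th basis vector is placed in degree `deg s j`. The differential
`F_{s+1} → F_s` is the matrix `d s`, and the augmentation `F₀ → I` sends the `j`-th basis vector
to `gen j`. All the maps preserve degrees. -/
structure GradedFreeResolution {k : Type*} [Field k] {n : ℕ}
    (I : Ideal (MvPolynomial (Fin n) k)) where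
  /-- the index set of the basis of `F_s` -/
  ι : ℕ → Type
  /-- the basis of `F_s` is finite -/
  fin : ∀ s, Fintype (ι s)
  /-- the degrees of the basis vectors of `F_s` -/
  deg : (s : ℕ) → ι s → ℕ
  /-- the images of the basis vectors of `F₀` in `I` -/
  gen : ι 0 → MvPolynomial (Fin n) k
  /-- the matrix of the differential `F_{s+1} → F_s` -/
  d : (s : ℕ) → Matrix (ι s) (ι (s + 1)) (MvPolynomial (Fin n) k)
  /-- the augmentation preserves degrees -/
  gen_homogeneous : ∀ j, (gen j).IsHomogeneous (deg 0 j)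
  /-- the differentials preserve degrees: the entry `(i, j)` is homogeneous of degree
  `deg j - deg i` (and zero if this is negative) -/
  d_homogeneous : ∀ s i j, ∀ m ∈ (d s i j).support, m.degree + deg s i = deg (s + 1) j
  /-- `F₀ → I` is surjective -/
  span_gen : Ideal.span (Set.range gen) = I
  /-- exactness at `F₀` -/
  exact_zero : Function.Exact (d 0).mulVecLin (Fintype.linearCombination (MvPolynomial (Fin n) k) gen)
  /-- exactness at `F_{s+1}` -/
  exact_succ : ∀ s, Function.Exact (d (s + 1)).mulVecLin (d s).mulVecLin

namespace GradedFreeResolution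

attribute [instance] GradedFreeResolution.fin

variable {k : Type*} [Field k] {n : ℕ} {I : Ideal (MvPolynomial (Fin n) k)}
  (F : GradedFreeResolution I)

/-- The differential `F_{s+1} ⊗ k → F_s ⊗ k`, where `k = S / (x₁, …, xₙ)` and
`F_s ⊗ k = (ι s → k)`: its matrix consists of the constant coefficients of the entries of `d s`. -/
def tensorD (s : ℕ) : (F.ι (s + 1) → k) →ₗ[k] (F.ι s → k) :=
  ((F.d s).map constantCoeff).mulVecLin

/-- The kernel of the differential of `F ⊗ k` that leaves `F_s ⊗ k`. -/
def cycles : (s : ℕ) → Submodule k (F.ι s → k)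
  | 0 => ⊤
  | s + 1 => LinearMap.ker (F.tensorD s)

/-- The image in `F_s ⊗ k` of `F_{s+1} ⊗ k`. -/
def boundaries (s : ℕ) : Submodule k (F.ι s → k) := LinearMap.range (F.tensorD s)

/-- The degree `e` component of the graded vector space `F_s ⊗ k`. -/
def degreePart (s e : ℕ) : Submodule k (F.ι s → k) where
  carrier := {v | ∀ j, F.deg s j ≠ e → v j = 0}
  add_mem' := by
    intro v w hv hw j hj
    simp [hv j hj, hw j hj]
  zero_mem' := by
    intro j _
    rfl
  smul_mem' := by
    intro c v hv j hj
    simp [hv j hj]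

/-- `Tor_s^S(I, k)_e`: the degree `e` component of the `s`-th homology of `F ⊗ k`. -/
abbrev Tor (s e : ℕ) : Type _ :=
  (F.cycles s ⊓ F.degreePart s e : Submodule k (F.ι s → k)) ⧸
    (F.boundaries s).comap (F.cycles s ⊓ F.degreePart s e).subtype

end GradedFreeResolution

/-- The condition `N_{d,p}`: for all `s ≤ p - 1`, the graded vector space `Tor_s^S(I, k)`
is concentrated in degree `d + s`. The `Tor` is computed from a graded free resolution of `I`. -/
def SatisfiesN {k : Type*} [Field k] {n : ℕ} (d p : ℕ) (I : Ideal (MvPolynomial (Fin n) k)) :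
    Prop :=
  ∃ F : GradedFreeResolution I, ∀ s < p, ∀ e, Nontrivial (F.Tor s e) → e = d + s

/-- `I` is a monomial ideal generated in degree `d`: it is generated by a set of monomials of
degree `d`. -/
def IsMonomialGeneratedInDegree {k : Type*} [Field k] {n : ℕ} (d : ℕ)
    (I : Ideal (MvPolynomial (Fin n) k)) : Prop :=
  ∃ A : Set (Fin n →₀ ℕ), (∀ a ∈ A, a.degree = d) ∧
    I = Ideal.span ((fun a => monomial a (1 : k)) '' A)

/-- The transition `I ↦ (I, f)` is a shelling move: `I : f` is generated by a subset of the
variables. -/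
def IsShellingMove {k : Type*} [Field k] {n : ℕ} (I : Ideal (MvPolynomial (Fin n) k))
    (f : MvPolynomial (Fin n) k) : Prop :=
  ∃ V : Set (Fin n), I.colon {f} = Ideal.span (X '' V)

end

/-! For part 1, resolve `(I, f)` and let `x^c f = x^q g` with `g` a monomial generator of `I`. If
`deg c ≥ 2`, this relation is a syzygy of degree at least `d + 2`, where `Tor₁` vanishes, so it is a
combination of syzygies with coefficients in the maximal ideal `m`. Taking the coefficient of `f`
sends syzygies into `I : f`, hence `x^c ∈ m (I : f)` (`monomial_mem_mul_colon`). Thus `I : f` has no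
minimal generator of degree at least 2, and none of degree 0 because `f ∉ I`.

For part 3, multiplication by `f` maps `(I : f)(-d)` to `I`. The mapping cone of a lift to
resolutions resolves `(I, f)`; its `s`-th term is `F_s` plus the `s`-th term of a resolution of `(S
/ (I : f))(-d)`. If `I : f` is generated by variables, the latter can be taken linear, with all
basis vectors in degree `d + s`, so no `Tor` appears in a degree where `I` had none. The linear
resolution itself comes from the same cone, adding one variable at a time. Part 2 combines the other
two. -/

noncomputable section

/-! ### Graded vectors and homogeneous preimages. -/

section Homogeneous

variable {k : Type*} [Field k] {n : ℕ} {ι κ : Type*}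

/-- The vector `v` is homogeneous of degree `D`, where the `i`-th basis vector has degree
`deg i`. -/
def IsHomogeneousVec (deg : ι → ℕ) (D : ℕ) (v : ι → MvPolynomial (Fin n) k) : Prop :=
  ∀ i, ∀ m ∈ (v i).support, m.degree + deg i = D

lemma IsHomogeneousVec.add {deg : ι → ℕ} {D : ℕ} {v w : ι → MvPolynomial (Fin n) k}
    (hv : IsHomogeneousVec deg D v) (hw : IsHomogeneousVec deg D w) :
    IsHomogeneousVec deg D (v + w) := by
  classical
  intro i m hm
  rcases Finset.mem_union.1 (support_add hm) with h | h
  exacts [hv i m h, hw i m h]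

lemma IsHomogeneousVec.neg {deg : ι → ℕ} {D : ℕ} {v : ι → MvPolynomial (Fin n) k}
    (hv : IsHomogeneousVec deg D v) : IsHomogeneousVec deg D (-v) := by
  intro i m hm
  rw [Pi.neg_apply, support_neg] at hm
  exact hv i m hm

lemma IsHomogeneousVec.sub {deg : ι → ℕ} {D : ℕ} {v w : ι → MvPolynomial (Fin n) k}
    (hv : IsHomogeneousVec deg D v) (hw : IsHomogeneousVec deg D w) :
    IsHomogeneousVec deg D (v - w) := by
  rw [sub_eq_add_neg]
  exact hv.add hw.neg

lemma IsHomogeneousVec.monomial_smul {deg : ι → ℕ} {D : ℕ} {v : ι → MvPolynomial (Fin n) k}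
    (hv : IsHomogeneousVec deg D v) (c : Fin n →₀ ℕ) :
    IsHomogeneousVec deg (c.degree + D) (monomial c (1 : k) • v) := by
  classical
  intro i m hm
  rw [Pi.smul_apply, smul_eq_mul] at hm
  obtain ⟨x, hx, y, hy, rfl⟩ := Finset.mem_add.1 (support_mul _ _ hm)
  have hx' := Finset.mem_singleton.1 (support_monomial_subset hx)
  rw [hx', map_add, add_assoc, hv i y hy]

lemma isHomogeneousVec_of_isHomogeneous {v : ι → MvPolynomial (Fin n) k} {deg : ι → ℕ} {D D' : ℕ}
    (h : ∀ i, (v i).IsHomogeneous D') (hD : ∀ i, D' + deg i = D) : IsHomogeneousVec deg D v := by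
  intro i m hm
  rw [← hD i, ← (h i) (mem_support_iff.1 hm), Finsupp.degree_eq_weight_one]
  rfl

/-- The degree `D` component of a vector of polynomials, the `i`-th basis vector having degree
`deg i`. -/
def vecComponent (deg : ι → ℕ) (D : ℕ) (v : ι → MvPolynomial (Fin n) k) :
    ι → MvPolynomial (Fin n) k :=
  fun i => if deg i ≤ D then homogeneousComponent (D - deg i) (v i) else 0

lemma coeff_vecComponent (deg : ι → ℕ) (D : ℕ) (v : ι → MvPolynomial (Fin n) k) (i : ι)
    (m : Fin n →₀ ℕ) :
    coeff m (vecComponent deg D v i) = if m.degree + deg i = D then coeff m (v i) else 0 := by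
  unfold vecComponent
  by_cases h : deg i ≤ D
  · rw [if_pos h, coeff_homogeneousComponent]
    exact if_congr (by omega) rfl rfl
  · rw [if_neg h, if_neg (by omega), coeff_zero]

lemma isHomogeneousVec_vecComponent (deg : ι → ℕ) (D : ℕ) (v : ι → MvPolynomial (Fin n) k) :
    IsHomogeneousVec deg D (vecComponent deg D v) := by
  intro i m hm
  rw [mem_support_iff, coeff_vecComponent] at hm
  by_contra h
  exact hm (if_neg h)

lemma IsHomogeneousVec.vecComponent_eq {deg : ι → ℕ} {D : ℕ} {v : ι → MvPolynomial (Fin n) k}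
    (hv : IsHomogeneousVec deg D v) : vecComponent deg D v = v := by
  funext i
  ext m
  rw [coeff_vecComponent]
  split_ifs with h
  · rfl
  · by_contra h'
    exact h (hv i m (mem_support_iff.2 (Ne.symm h')))

lemma vecComponent_mulVec [Fintype κ] {r : ι → ℕ} {c : κ → ℕ}
    {M : Matrix ι κ (MvPolynomial (Fin n) k)} (hM : ∀ j, IsHomogeneousVec r (c j) (M.col j))
    (D : ℕ) (w : κ → MvPolynomial (Fin n) k) :
    vecComponent r D (M.mulVec w) = M.mulVec (vecComponent c D w) := by
  classical
  funext i
  ext m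
  rw [coeff_vecComponent]
  simp only [Matrix.mulVec, dotProduct, coeff_sum, coeff_mul, coeff_vecComponent]
  have key : ∀ j, ∀ x ∈ Finset.HasAntidiagonal.antidiagonal m, (coeff x.1 (M i j) *
      if x.2.degree + c j = D then coeff x.2 (w j) else 0) =
      if m.degree + r i = D then coeff x.1 (M i j) * coeff x.2 (w j) else 0 := by
    intro j x hx
    rw [Finset.HasAntidiagonal.mem_antidiagonal] at hx
    by_cases h0 : coeff x.1 (M i j) = 0
    · simp [h0]
    · have h1 : x.1.degree + r i = c j := hM j i x.1 (mem_support_iff.2 h0)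
      have h2 : x.1.degree + x.2.degree = m.degree := by rw [← map_add, hx]
      rw [mul_ite, mul_zero]
      exact if_congr (by omega) rfl rfl
  rw [Finset.sum_congr rfl fun j _ => Finset.sum_congr rfl (key j)]
  split_ifs <;> simp

/-- A graded matrix commutes with degree components, so the degree `D` component of any preimage is
again a preimage. -/
lemma exists_isHomogeneousVec_mulVec_eq [Fintype κ] {r : ι → ℕ} {c : κ → ℕ}
    {M : Matrix ι κ (MvPolynomial (Fin n) k)} (hM : ∀ j, IsHomogeneousVec r (c j) (M.col j))
    {D : ℕ} {v : ι → MvPolynomial (Fin n) k} (hv : IsHomogeneousVec r D v)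
    (h : ∃ w, M.mulVec w = v) : ∃ w, IsHomogeneousVec c D w ∧ M.mulVec w = v := by
  obtain ⟨w, rfl⟩ := h
  exact ⟨vecComponent c D w, isHomogeneousVec_vecComponent c D w, by
    rw [← vecComponent_mulVec hM, hv.vecComponent_eq]⟩

lemma exists_isHomogeneousVec_linearCombination_eq [Fintype κ] {c : κ → ℕ}
    {g : κ → MvPolynomial (Fin n) k} (hg : ∀ j, (g j).IsHomogeneous (c j)) {D : ℕ}
    {p : MvPolynomial (Fin n) k} (hp : p.IsHomogeneous D) (h : p ∈ Ideal.span (Set.range g)) :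
    ∃ w, IsHomogeneousVec c D w ∧
      Fintype.linearCombination (MvPolynomial (Fin n) k) g w = p := by
  obtain ⟨w, hw⟩ := Ideal.mem_span_range_iff_exists_fun.1 h
  -- The generators form a matrix with a single row, placed in degree 0.
  obtain ⟨w', h1, h2⟩ := exists_isHomogeneousVec_mulVec_eq (ι := Unit) (r := fun _ => 0)
    (M := fun _ j => g j) (v := fun _ => p) (D := D) (c := c)
    (fun j => isHomogeneousVec_of_isHomogeneous (D' := c j) (fun _ => hg j) (fun _ => rfl))
    (isHomogeneousVec_of_isHomogeneous (D' := D) (fun _ => hp) (fun _ => rfl))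
    ⟨w, by
      funext
      rw [← hw]
      simp [Matrix.mulVec, dotProduct, mul_comm]⟩
  refine ⟨w', h1, ?_⟩
  rw [← congrFun h2 ()]
  simp [Matrix.mulVec, dotProduct, mul_comm, Fintype.linearCombination_apply]

end Homogeneous

/-! ### Vanishing of `Tor₁` and the colon ideal. -/

namespace GradedFreeResolution

variable {k : Type*} [Field k] {n : ℕ} {I : Ideal (MvPolynomial (Fin n) k)}
  (F : GradedFreeResolution I)

lemma nontrivial_tor_iff (s e : ℕ) :
    Nontrivial (F.Tor s e) ↔ ∃ v ∈ F.cycles s ⊓ F.degreePart s e, v ∉ F.boundaries s := by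
  rw [Submodule.Quotient.nontrivial_iff, Ne, Submodule.eq_top_iff']
  simp [and_assoc]

lemma isHomogeneousVec_col_d (s : ℕ) (j : F.ι (s + 1)) :
    IsHomogeneousVec (F.deg s) (F.deg (s + 1) j) ((F.d s).col j) :=
  fun i => F.d_homogeneous s i j

lemma tensorD_comp_constantCoeff (s : ℕ) (w : F.ι (s + 1) → MvPolynomial (Fin n) k) :
    F.tensorD s (constantCoeff ∘ w) = constantCoeff ∘ (F.d s).mulVec w := by
  funext i
  exact (RingHom.map_mulVec constantCoeff (F.d s) w i).symm

lemma gen_mem (j : F.ι 0) : F.gen j ∈ I := by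
  have h : F.gen j ∈ Ideal.span (Set.range F.gen) := Ideal.subset_span ⟨j, rfl⟩
  rwa [F.span_gen] at h

/-- If `Tor₁` vanishes in degree `D`, then every homogeneous syzygy of degree `D` without constant
coefficients is a combination of syzygies with coefficients in the homogeneous maximal ideal. -/
lemma exists_lift_of_not_nontrivial_tor {D : ℕ} (hT : ¬ Nontrivial (F.Tor 1 D))
    {z : F.ι 0 → MvPolynomial (Fin n) k} (hz : IsHomogeneousVec (F.deg 0) D z)
    (hz0 : Fintype.linearCombination (MvPolynomial (Fin n) k) F.gen z = 0)
    (hzc : constantCoeff ∘ z = 0) :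
    ∃ w, (F.d 0).mulVec w = z ∧ ∀ j, constantCoeff (w j) = 0 := by
  obtain ⟨w, hw, hwz⟩ := exists_isHomogeneousVec_mulVec_eq (F.isHomogeneousVec_col_d 0) hz
    ((F.exact_zero z).1 hz0)
  rw [nontrivial_tor_iff] at hT
  push Not at hT
  obtain ⟨u, hu⟩ := hT (constantCoeff ∘ w) ⟨by
      change F.tensorD 0 _ = 0
      rw [tensorD_comp_constantCoeff, hwz, hzc], by
      intro j hj
      by_contra h
      have := hw j 0 (mem_support_iff.2 h)
      rw [map_zero, zero_add] at this
      exact hj this⟩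
  have hu' : (constantCoeff ∘ fun j => (C (u j) : MvPolynomial (Fin n) k)) = u := by
    funext j
    simp
  -- The constant part of `w` is a cycle of `F ⊗ k`, hence the boundary of some `u`. Subtracting the
  -- differential of the constant lift of `u` removes the constants of `w` without changing its
  -- image.
  refine ⟨w - (F.d 1).mulVec fun j => C (u j), ?_, fun j => ?_⟩
  · rw [Matrix.mulVec_sub, hwz]
    have h : (F.d 0).mulVecLin ((F.d 1).mulVecLin fun j => C (u j)) = 0 :=
      (F.exact_succ 0).apply_apply_eq_zero _
    rw [Matrix.mulVecLin_apply, Matrix.mulVecLin_apply] at h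
    rw [h, sub_zero]
  · have h := congrFun (F.tensorD_comp_constantCoeff 1 fun j => C (u j)) j
    rw [hu'] at h
    rw [Pi.sub_apply, map_sub, sub_eq_zero]
    exact (congrFun hu j).symm.trans h

/-- Let `F` be a resolution of `(I, f)`, let `g ∈ I` and let `f`, `g` be homogeneous of degree `d`.
If `x^c f = x^q g` with `c, q ≠ 0` and `Tor₁((I, f), k)` vanishes in the degree of this element,
then `x^c` lies in `(x₁, …, xₙ) (I : f)`. -/
lemma monomial_mem_mul_colon {f g : MvPolynomial (Fin n) k} {d : ℕ}
    (F : GradedFreeResolution (I ⊔ Ideal.span {f})) (hf : f.IsHomogeneous d)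
    (hg : g.IsHomogeneous d) (hgI : g ∈ I) {c q : Fin n →₀ ℕ} (hc : c ≠ 0)
    (hcq : c.degree = q.degree) (h : monomial c 1 * f = monomial q 1 * g)
    (hT : ¬ Nontrivial (F.Tor 1 (c.degree + d))) :
    monomial c 1 ∈ RingHom.ker (constantCoeff (R := k) (σ := Fin n)) * I.colon {f} := by
  set L := Fintype.linearCombination (MvPolynomial (Fin n) k) F.gen
  have hq : q ≠ 0 := by
    rintro rfl
    rw [map_zero, Finsupp.degree_eq_zero_iff] at hcq
    exact hc hcq
  have hker : ∀ c : Fin n →₀ ℕ, c ≠ 0 →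
      monomial c (1 : k) ∈ RingHom.ker (constantCoeff (R := k) (σ := Fin n)) := by
    intro c hc
    rw [RingHom.mem_ker, constantCoeff_monomial, if_neg hc]
  -- The resolution need not be minimal, nor `f` be one of its generators. Writing each generator as
  -- `b j * f` modulo `I` gives the functional `B`, a coefficient of `f` well defined modulo `I :
  -- f`.
  have hgen : ∀ j, ∃ b, F.gen j - b * f ∈ I := by
    intro j
    obtain ⟨y, hy, z, hz, hyz⟩ := Submodule.mem_sup.1 (F.gen_mem j)
    obtain ⟨b, rfl⟩ := Ideal.mem_span_singleton'.1 hz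
    exact ⟨b, by rw [← hyz, add_sub_cancel_right]; exact hy⟩
  choose b hb using hgen
  set B := Fintype.linearCombination (MvPolynomial (Fin n) k) b
  have hB : ∀ z, L z - B z * f ∈ I := by
    intro z
    simp only [L, B, Fintype.linearCombination_apply, Finset.sum_mul, ← Finset.sum_sub_distrib,
      smul_eq_mul, mul_assoc, ← mul_sub]
    exact Ideal.sum_mem _ fun j _ => I.mul_mem_left _ (hb j)
  have hK : ∀ x, x ∈ I.colon {f} ↔ x * f ∈ I := fun x => Submodule.mem_colon_singleton
  obtain ⟨α, hα, hαf⟩ := exists_isHomogeneousVec_linearCombination_eq F.gen_homogeneous hf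
    (by rw [F.span_gen]; exact Ideal.mem_sup_right (Ideal.mem_span_singleton_self f))
  obtain ⟨β, hβ, hβg⟩ := exists_isHomogeneousVec_linearCombination_eq F.gen_homogeneous hg
    (by rw [F.span_gen]; exact Ideal.mem_sup_left hgI)
  have hz : IsHomogeneousVec (F.deg 0) (c.degree + d)
      (monomial c (1 : k) • α - monomial q (1 : k) • β) :=
    (hα.monomial_smul c).sub (by rw [hcq]; exact hβ.monomial_smul q)
  obtain ⟨w, hw, hwc⟩ := F.exists_lift_of_not_nontrivial_tor hT hz
    (by rw [map_sub, map_smul, map_smul, hαf, hβg, smul_eq_mul, smul_eq_mul, h, sub_self])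
    (by
      funext j
      simp [constantCoeff_monomial, hc, hq])
  have hcol : ∀ y, (F.d 0).mulVec y = ∑ j, y j • (F.d 0).col j := by
    intro y
    funext i
    simp [Matrix.mulVec, dotProduct, mul_comm, Matrix.col]
  have h1 : B (monomial c (1 : k) • α - monomial q (1 : k) • β) ∈
      RingHom.ker (constantCoeff (R := k) (σ := Fin n)) * I.colon {f} := by
    classical
    rw [← hw, hcol, map_sum]
    refine Ideal.sum_mem _ fun j _ => ?_
    rw [map_smul, smul_eq_mul]
    refine Ideal.mul_mem_mul (hwc j) ((hK _).2 ?_)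
    have hL : L ((F.d 0).col j) = 0 := by
      rw [← Matrix.mulVec_single_one]
      exact F.exact_zero.apply_apply_eq_zero (Pi.single j 1)
    have := hB ((F.d 0).col j)
    rwa [hL, zero_sub, neg_mem_iff] at this
  have h2 : 1 - B α ∈ I.colon {f} := by
    rw [hK, sub_mul, one_mul]
    have := hB α
    rwa [hαf] at this
  have h3 : B β ∈ I.colon {f} := by
    rw [hK]
    have := I.sub_mem hgI (hB β)
    rwa [hβg, sub_sub_cancel] at this
  -- `B α` need not be 1 and `B β` need not be 0; both errors lie in `I : f`, and the factors `x^c`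
  -- and `x^q` put them in `m (I : f)`.
  have h4 : monomial c (1 : k) = B (monomial c (1 : k) • α - monomial q (1 : k) • β) +
      monomial c (1 : k) * (1 - B α) + monomial q (1 : k) * B β := by
    rw [map_sub, map_smul, map_smul, smul_eq_mul, smul_eq_mul]
    ring
  rw [h4]
  exact add_mem (add_mem h1 (Ideal.mul_mem_mul (hker c hc) h2)) (Ideal.mul_mem_mul (hker q hq) h3)

end GradedFreeResolution

/-! ### From `N_{d,2}` of `(I, f)` to a shelling move. -/

section Shelling

variable {k : Type*} [Field k] {n : ℕ}

lemma isHomogeneous_monomial_degree (a : Fin n →₀ ℕ) :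
    (monomial a (1 : k)).IsHomogeneous a.degree :=
  isHomogeneous_monomial 1 rfl

lemma mem_colon_monomial_iff {A : Set (Fin n →₀ ℕ)} {a : Fin n →₀ ℕ}
    {p : MvPolynomial (Fin n) k} :
    p ∈ (Ideal.span ((fun a => monomial a (1 : k)) '' A)).colon {monomial a (1 : k)} ↔
      ∀ m ∈ p.support, ∃ b ∈ A, b ≤ m + a := by
  rw [Submodule.mem_colon_singleton, smul_eq_mul, mem_ideal_span_monomial_image]
  constructor
  · intro h m hm
    refine h _ ?_
    rw [mem_support_iff, coeff_mul_monomial, mul_one]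
    exact mem_support_iff.1 hm
  · intro h m hm
    classical
    obtain ⟨x, hx, y, hy, rfl⟩ := Finset.mem_add.1 (support_mul _ _ hm)
    rw [Finset.mem_singleton.1 (support_monomial_subset hy)]
    exact h x hx

lemma isShellingMove_of_satisfiesN_sup {d : ℕ} {I : Ideal (MvPolynomial (Fin n) k)}
    (hI : IsMonomialGeneratedInDegree d I) {a : Fin n →₀ ℕ} (ha : a.degree = d)
    (hf : monomial a (1 : k) ∉ I)
    (hN : SatisfiesN d 2 (I ⊔ Ideal.span {monomial a (1 : k)})) :
    IsShellingMove I (monomial a (1 : k)) := by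
  classical
  obtain ⟨A, hA, rfl⟩ := hI
  obtain ⟨F, hF⟩ := hN
  -- A monomial of `I : f` of degree at least 2 is a variable times another monomial of `I : f`.
  have hstep : ∀ c : Fin n →₀ ℕ, 2 ≤ c.degree → (∃ b ∈ A, b ≤ c + a) →
      ∃ c' : Fin n →₀ ℕ, ∃ i, c = Finsupp.single i 1 + c' ∧ ∃ b ∈ A, b ≤ c' + a := by
    rintro c hc ⟨b, hb, hbc⟩
    obtain ⟨q, hq⟩ := exists_add_of_le hbc
    have hdeg : c.degree = q.degree := by
      have := congrArg Finsupp.degree hq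
      rw [map_add, map_add, ha, hA b hb] at this
      omega
    have hmem := F.monomial_mem_mul_colon (ha ▸ isHomogeneous_monomial_degree a)
      (hA b hb ▸ isHomogeneous_monomial_degree b) (Ideal.subset_span ⟨b, hb, rfl⟩)
      (c := c) (q := q) (by rintro rfl; simp at hc) hdeg
      (by simp only [monomial_mul, one_mul]; rw [hq, add_comm])
      (fun h => by have := hF 1 (by norm_num) _ h; omega)
    have key : ∀ p ∈ RingHom.ker (constantCoeff (R := k) (σ := Fin n)) *
        (Ideal.span ((fun a => monomial a (1 : k)) '' A)).colon {monomial a (1 : k)},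
        ∀ m ∈ p.support, ∃ c' : Fin n →₀ ℕ, ∃ i, m = Finsupp.single i 1 + c' ∧
          ∃ b ∈ A, b ≤ c' + a := by
      intro p hp
      refine Submodule.mul_induction_on hp ?_ ?_
      · intro x hx y hy m hm
        obtain ⟨u, hu, v, hv, rfl⟩ := Finset.mem_add.1 (support_mul _ _ hm)
        have hu0 : u ≠ 0 := by
          rintro rfl
          exact mem_support_iff.1 hu hx
        obtain ⟨i, hi⟩ := Finsupp.ne_iff.1 hu0
        obtain ⟨u', rfl⟩ := exists_add_of_le
          (Finsupp.single_le_iff.2 (Nat.one_le_iff_ne_zero.2 hi))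
        obtain ⟨b', hb', hle⟩ := mem_colon_monomial_iff.1 hy v hv
        exact ⟨u' + v, i, add_assoc _ _ _, b', hb', hle.trans (by
          rw [add_assoc]
          exact le_add_of_nonneg_left zero_le)⟩
      · intro x y hx hy m hm
        rcases Finset.mem_union.1 (support_add hm) with h | h
        exacts [hx m h, hy m h]
    exact key _ hmem c (by simp)
  -- Descent on the degree reaches a variable of `I : f` dividing `x^c`; degree 0 would give `f ∈
  -- I`.
  have hvar : ∀ t : ℕ, ∀ c : Fin n →₀ ℕ, c.degree = t → (∃ b ∈ A, b ≤ c + a) →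
      ∃ i, (∃ b ∈ A, b ≤ Finsupp.single i 1 + a) ∧ c i ≠ 0 := by
    intro t
    induction t with
    | zero =>
      rintro c hc ⟨b, hb, hle⟩
      rw [Finsupp.degree_eq_zero_iff] at hc
      subst hc
      refine absurd (mem_ideal_span_monomial_image.2 fun m hm => ?_) hf
      rw [Finset.mem_singleton.1 (support_monomial_subset hm)]
      exact ⟨b, hb, by simpa using hle⟩
    | succ t ih =>
      intro c hc hb
      by_cases h2 : 2 ≤ c.degree
      · obtain ⟨c', i, rfl, hb'⟩ := hstep c h2 hb
        obtain ⟨j, hj, hj'⟩ := ih c' (by rw [map_add, Finsupp.degree_single] at hc; omega) hb'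
        exact ⟨j, hj, by rw [Finsupp.add_apply]; omega⟩
      · have hc0 : c ≠ 0 := by
          rintro rfl
          simp at hc
        obtain ⟨i, hi⟩ := Finsupp.ne_iff.1 hc0
        obtain ⟨u, rfl⟩ := exists_add_of_le
          (Finsupp.single_le_iff.2 (Nat.one_le_iff_ne_zero.2 hi))
        have hu : u = 0 := by
          rw [← Finsupp.degree_eq_zero_iff]
          rw [map_add, Finsupp.degree_single] at h2
          omega
        subst hu
        exact ⟨i, by simpa using hb, hi⟩
  refine ⟨{i | ∃ b ∈ A, b ≤ Finsupp.single i 1 + a}, ?_⟩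
  ext p
  rw [mem_colon_monomial_iff, mem_ideal_span_X_image]
  refine forall₂_congr fun m _ => ⟨fun h => hvar _ m rfl h, ?_⟩
  rintro ⟨i, ⟨b, hb, hle⟩, hi⟩
  refine ⟨b, hb, hle.trans (add_le_add_left ?_ a)⟩
  exact Finsupp.single_le_iff.2 (Nat.one_le_iff_ne_zero.2 hi)

end Shelling

section Homogeneous

variable {k : Type*} [Field k] {n : ℕ} {ι κ : Type*}

lemma IsHomogeneousVec.mulVec [Fintype κ] {r : ι → ℕ} {c : κ → ℕ}
    {M : Matrix ι κ (MvPolynomial (Fin n) k)} (hM : ∀ j, IsHomogeneousVec r (c j) (M.col j))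
    {D : ℕ} {w : κ → MvPolynomial (Fin n) k} (hw : IsHomogeneousVec c D w) :
    IsHomogeneousVec r D (M.mulVec w) := by
  rw [← hw.vecComponent_eq, ← vecComponent_mulVec hM]
  exact isHomogeneousVec_vecComponent r D _

end Homogeneous

lemma exists_seq_of_step {α : ℕ → Type*} {P : ∀ s, α s → Prop} {R : ∀ s, α s → α (s + 1) → Prop}
    {x₀ : α 0} (h₀ : P 0 x₀) (step : ∀ s x, P s x → ∃ y, P (s + 1) y ∧ R s x y) :
    ∃ x : ∀ s, α s, x 0 = x₀ ∧ ∀ s, P s (x s) ∧ R s (x s) (x (s + 1)) := by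
  choose next h1 h2 using step
  let x : ∀ s, {y : α s // P s y} := fun s =>
    Nat.rec ⟨x₀, h₀⟩ (fun s y => ⟨next s y.1 y.2, h1 s y.1 y.2⟩) s
  exact ⟨fun s => (x s).1, rfl, fun s => ⟨(x s).2, h2 s (x s).1 (x s).2⟩⟩

/-! ### Comparison maps and the mapping cone. -/

namespace GradedFreeResolution

variable {k : Type*} [Field k] {n : ℕ} {I K : Ideal (MvPolynomial (Fin n) k)}

section Augmented

variable (H : GradedFreeResolution K)

/-- The bases of the free resolution `⋯ → H₁ → H₀ → S` of `S / K`. -/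
def augι : ℕ → Type
  | 0 => Unit
  | s + 1 => H.ι s

instance augFintype : ∀ s, Fintype (H.augι s)
  | 0 => inferInstanceAs (Fintype Unit)
  | s + 1 => H.fin s

/-- The degrees of the basis vectors of the resolution of `(S / K)(-d)`. -/
def augDeg (d : ℕ) : (s : ℕ) → H.augι s → ℕ
  | 0 => fun _ => d
  | s + 1 => fun j => H.deg s j + d

/-- The differentials of the free resolution `⋯ → H₁ → H₀ → S` of `S / K`. -/
def augD : (s : ℕ) → Matrix (H.augι s) (H.augι (s + 1)) (MvPolynomial (Fin n) k)
  | 0 => fun _ j => H.gen j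
  | s + 1 => H.d s

/-- The basis vector of `S` in the free resolution of `S / K`. -/
def augOne : H.augι 0 := ()

/-- The generators of `K`, as the augmentation `H₀ → S`. -/
def augGen : H.augι 1 → MvPolynomial (Fin n) k := H.gen

lemma augGen_mem (j : H.augι 1) : H.augGen j ∈ K := H.gen_mem j

lemma augGen_isHomogeneous_mul {f : MvPolynomial (Fin n) k} {d : ℕ} (hf : f.IsHomogeneous d)
    (j : H.augι 1) : (H.augGen j * f).IsHomogeneous (H.augDeg d 1 j) :=
  (H.gen_homogeneous j).mul hf

lemma augD_zero_mulVec (w : H.augι 1 → MvPolynomial (Fin n) k) :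
    (H.augD 0).mulVec w H.augOne = ∑ j, w j * H.augGen j :=
  Finset.sum_congr rfl fun _ _ => mul_comm _ _

lemma augD_zero_mulVec_eq_zero_iff (w : H.augι 1 → MvPolynomial (Fin n) k) :
    (H.augD 0).mulVec w = 0 ↔
      Fintype.linearCombination (MvPolynomial (Fin n) k) (α := H.ι 0) H.gen w = 0 :=
  ⟨fun h => (H.augD_zero_mulVec w).symm.trans (congrFun h H.augOne),
    fun h => funext fun _ => (H.augD_zero_mulVec w).trans h⟩

lemma exact_augD (s : ℕ) :
    Function.Exact (H.augD (s + 1)).mulVecLin (H.augD s).mulVecLin := by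
  cases s with
  | zero => exact fun w => (H.augD_zero_mulVec_eq_zero_iff w).trans (H.exact_zero w)
  | succ s => exact H.exact_succ s

lemma exists_augD_zero_mulVec_eq {w : H.augι 0 → MvPolynomial (Fin n) k} (h : w H.augOne ∈ K) :
    ∃ w', (H.augD 0).mulVec w' = w := by
  obtain ⟨c, hc⟩ := Ideal.mem_span_range_iff_exists_fun.1 (H.span_gen.ge h)
  exact ⟨c, funext fun _ => (H.augD_zero_mulVec c).trans hc⟩

/-- The augmentation moves `H_s`, generated in degree `1 + s`, to position `s + 1`, so the twist by
`d` gives degree `d + s` at every position, including 0. -/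
lemma augDeg_of_linear (hH : ∀ s j, H.deg s j = 1 + s) (d s : ℕ) (j : H.augι s) :
    H.augDeg d s j = d + s := by
  cases s with
  | zero => rfl
  | succ s => exact (congrArg (· + d) (hH s j)).trans (by omega)

lemma isHomogeneousVec_col_augD (d s : ℕ) (j : H.augι (s + 1)) :
    IsHomogeneousVec (H.augDeg d s) (H.augDeg d (s + 1) j) ((H.augD s).col j) := by
  cases s with
  | zero =>
    exact isHomogeneousVec_of_isHomogeneous (D' := H.deg 0 j) (fun _ => H.gen_homogeneous j)
      fun _ => rfl
  | succ s =>
    intro i m hm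
    have h := H.d_homogeneous s i j m hm
    change m.degree + (H.deg s i + d) = H.deg (s + 1) j + d
    omega

end Augmented

/-- A lift to resolutions of the multiplication by `f`, as a map from `K(-d)` to `I`. -/
structure ConeMap (F : GradedFreeResolution I) (H : GradedFreeResolution K)
    (f : MvPolynomial (Fin n) k) (d : ℕ) where
  /-- the components of the chain map -/
  φ : (s : ℕ) → Matrix (F.ι s) (H.augι (s + 1)) (MvPolynomial (Fin n) k)
  /-- the components preserve degrees -/
  homogeneous : ∀ s j, IsHomogeneousVec (F.deg s) (H.augDeg d (s + 1) j) ((φ s).col j)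
  /-- compatibility with the augmentations -/
  comm_zero : ∀ w, Fintype.linearCombination (MvPolynomial (Fin n) k) F.gen ((φ 0).mulVec w) =
    (H.augD 0).mulVec w H.augOne * f
  /-- compatibility with the differentials -/
  comm_succ : ∀ s w, (F.d s).mulVec ((φ (s + 1)).mulVec w) =
    (φ s).mulVec ((H.augD (s + 1)).mulVec w)

lemma exists_matrix_of_col {ι κ μ : Type*} [Fintype ι] [Fintype κ]
    {A : Matrix μ ι (MvPolynomial (Fin n) k)} {B : Matrix μ κ (MvPolynomial (Fin n) k)}
    {r : ι → ℕ} {c : κ → ℕ}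
    (h : ∀ j, ∃ v, IsHomogeneousVec r (c j) v ∧ A.mulVec v = B.col j) :
    ∃ M : Matrix ι κ (MvPolynomial (Fin n) k), (∀ j, IsHomogeneousVec r (c j) (M.col j)) ∧
      A * M = B := by
  choose v hv hB using h
  exact ⟨fun i j => v j i, hv, Matrix.ext fun i j => congrFun (hB j) i⟩

/-- The comparison theorem: each column is lifted homogeneously using the exactness of `F`. -/
lemma nonempty_coneMap (F : GradedFreeResolution I) (H : GradedFreeResolution K)
    {f : MvPolynomial (Fin n) k} {d : ℕ} (hf : f.IsHomogeneous d) (hK : ∀ x ∈ K, x * f ∈ I) :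
    Nonempty (ConeMap F H f d) := by
  classical
  have h0 : ∀ j, ∃ v, IsHomogeneousVec (F.deg 0) (H.augDeg d 1 j) v ∧
      Fintype.linearCombination (MvPolynomial (Fin n) k) F.gen v = H.augGen j * f := fun j =>
    exists_isHomogeneousVec_linearCombination_eq F.gen_homogeneous
      (H.augGen_isHomogeneous_mul hf j) (by rw [F.span_gen]; exact hK _ (H.augGen_mem j))
  choose v hv hvf using h0
  let φ₀ : Matrix (F.ι 0) (H.augι 1) (MvPolynomial (Fin n) k) := fun i j => v j i
  have hφ₀ : ∀ w, Fintype.linearCombination (MvPolynomial (Fin n) k) F.gen (φ₀.mulVec w) =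
      (H.augD 0).mulVec w H.augOne * f := by
    intro w
    have h1 : φ₀.mulVec w = ∑ j, w j • v j := by
      funext i
      simp [Matrix.mulVec, dotProduct, mul_comm, φ₀]
    rw [h1, map_sum, augD_zero_mulVec, Finset.sum_mul]
    refine Finset.sum_congr rfl fun j _ => ?_
    rw [map_smul, hvf, smul_eq_mul, mul_assoc]
  obtain ⟨φ, hφ0, hφ⟩ := exists_seq_of_step
    (α := fun s => Matrix (F.ι s) (H.augι (s + 1)) (MvPolynomial (Fin n) k))
    -- The second half of the invariant says that the composite to be lifted lands in the image of
    -- `F.d s`, which is what the next step needs.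
    (P := fun s M => (∀ j, IsHomogeneousVec (F.deg s) (H.augDeg d (s + 1) j) (M.col j)) ∧
      ∀ w, ∃ y, (F.d s).mulVec y = M.mulVec ((H.augD (s + 1)).mulVec w))
    (R := fun s M M' => F.d s * M' = M * H.augD (s + 1)) (x₀ := φ₀)
    ⟨hv, fun w => (F.exact_zero _).1 (by
      rw [hφ₀]
      have h : (H.augD 0).mulVec ((H.augD 1).mulVec w) = 0 :=
        (H.exact_augD 0).apply_apply_eq_zero w
      rw [h, Pi.zero_apply, zero_mul])⟩
    (by
      rintro s M ⟨hM, hy⟩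
      obtain ⟨M', hM', hMM'⟩ := exists_matrix_of_col (A := F.d s) (B := M * H.augD (s + 1))
        (r := F.deg (s + 1)) (c := H.augDeg d (s + 2)) (fun j =>
          exists_isHomogeneousVec_mulVec_eq (F.isHomogeneousVec_col_d s)
            (IsHomogeneousVec.mulVec hM (H.isHomogeneousVec_col_augD d (s + 1) j)) (by
              obtain ⟨y, hy⟩ := hy (Pi.single j 1)
              exact ⟨y, by rw [hy, Matrix.mulVec_single_one]; rfl⟩))
      refine ⟨M', ⟨hM', fun w => (F.exact_succ s _).1 ?_⟩, hMM'⟩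
      have h : (H.augD (s + 1)).mulVec ((H.augD (s + 2)).mulVec w) = 0 :=
        (H.exact_augD (s + 1)).apply_apply_eq_zero w
      rw [Matrix.mulVecLin_apply, Matrix.mulVec_mulVec, hMM', ← Matrix.mulVec_mulVec, h,
        Matrix.mulVec_zero])
  exact ⟨{
    φ := φ
    homogeneous := fun s => (hφ s).1.1
    comm_zero := by rw [hφ0]; exact hφ₀
    comm_succ := fun s w => by
      rw [Matrix.mulVec_mulVec, Matrix.mulVec_mulVec, (hφ s).2] }⟩

namespace ConeMap

variable {F : GradedFreeResolution I} {H : GradedFreeResolution K}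
  {f : MvPolynomial (Fin n) k} {d : ℕ} (Φ : ConeMap F H f d)

/-- The generators of `(I, f)` in the mapping cone. -/
def coneGen (F : GradedFreeResolution I) (H : GradedFreeResolution K)
    (f : MvPolynomial (Fin n) k) : F.ι 0 ⊕ H.augι 0 → MvPolynomial (Fin n) k :=
  Sum.elim F.gen fun _ => f

/-- The differentials of the mapping cone. -/
def coneD (s : ℕ) : Matrix (F.ι s ⊕ H.augι s) (F.ι (s + 1) ⊕ H.augι (s + 1))
    (MvPolynomial (Fin n) k) :=
  Matrix.fromBlocks (F.d s) (Φ.φ s) 0 (-H.augD s)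

lemma coneD_mulVec_elim (s : ℕ) (v : F.ι (s + 1) → MvPolynomial (Fin n) k)
    (w : H.augι (s + 1) → MvPolynomial (Fin n) k) :
    (Φ.coneD s).mulVec (Sum.elim v w) =
      Sum.elim ((F.d s).mulVec v + (Φ.φ s).mulVec w) (-(H.augD s).mulVec w) := by
  rw [coneD, Matrix.fromBlocks_mulVec, Sum.elim_comp_inl, Sum.elim_comp_inr, Matrix.zero_mulVec,
    zero_add, Matrix.neg_mulVec]

lemma linearCombination_coneGen (v : F.ι 0 → MvPolynomial (Fin n) k)
    (w : H.augι 0 → MvPolynomial (Fin n) k) :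
    Fintype.linearCombination (MvPolynomial (Fin n) k) (coneGen F H f) (Sum.elim v w) =
      Fintype.linearCombination (MvPolynomial (Fin n) k) F.gen v + w H.augOne * f := by
  simp only [Fintype.linearCombination_apply, coneGen, Fintype.sum_sum_type, Sum.elim_inl,
    Sum.elim_inr]
  congr 1
  exact Fintype.sum_unique (ι := Unit) _

lemma exact_coneD (s : ℕ) :
    Function.Exact (Φ.coneD (s + 1)).mulVecLin (Φ.coneD s).mulVecLin := by
  intro x
  obtain ⟨v, w, rfl⟩ : ∃ v w, x = Sum.elim v w := ⟨_, _, (Sum.elim_comp_inl_inr x).symm⟩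
  rw [Matrix.mulVecLin_apply, coneD_mulVec_elim]
  constructor
  · intro h
    have h1 : (F.d s).mulVec v + (Φ.φ s).mulVec w = 0 := funext fun i => congrFun h (Sum.inl i)
    have h2 : (H.augD s).mulVec w = 0 := funext fun i => by
      simpa using congrFun h (Sum.inr i)
    obtain ⟨y, hy⟩ := (H.exact_augD s w).1 h2
    rw [Matrix.mulVecLin_apply] at hy
    obtain ⟨u, hu⟩ := (F.exact_succ s (v + (Φ.φ (s + 1)).mulVec y)).1 (by
      rw [Matrix.mulVecLin_apply, Matrix.mulVec_add, Φ.comm_succ, hy, h1])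
    rw [Matrix.mulVecLin_apply] at hu
    -- The sign of `y` cancels that of the block `-H.augD`; `u` absorbs the resulting term `Φ.φ y`.
    refine ⟨Sum.elim u (-y), ?_⟩
    rw [Matrix.mulVecLin_apply, coneD_mulVec_elim, Matrix.mulVec_neg, Matrix.mulVec_neg, neg_neg,
      hu, hy, add_neg_cancel_right]
  · rintro ⟨y, hy⟩
    obtain ⟨u, z, rfl⟩ : ∃ u z, y = Sum.elim u z := ⟨_, _, (Sum.elim_comp_inl_inr y).symm⟩
    rw [Matrix.mulVecLin_apply, coneD_mulVec_elim] at hy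
    have hv : (F.d (s + 1)).mulVec u + (Φ.φ (s + 1)).mulVec z = v :=
      funext fun i => congrFun hy (Sum.inl i)
    have hw : -(H.augD (s + 1)).mulVec z = w := funext fun i => congrFun hy (Sum.inr i)
    have h1 : (F.d s).mulVec ((F.d (s + 1)).mulVec u) = 0 :=
      (F.exact_succ s).apply_apply_eq_zero u
    have h2 : (H.augD s).mulVec ((H.augD (s + 1)).mulVec z) = 0 :=
      (H.exact_augD s).apply_apply_eq_zero z
    rw [← hv, ← hw, Matrix.mulVec_add, h1, Φ.comm_succ, Matrix.mulVec_neg, Matrix.mulVec_neg, h2,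
      zero_add, add_neg_cancel, neg_zero, neg_zero]
    exact Sum.elim_zero_zero

lemma exact_coneD_zero (hK : ∀ x, x * f ∈ I → x ∈ K) :
    Function.Exact (Φ.coneD 0).mulVecLin
      (Fintype.linearCombination (MvPolynomial (Fin n) k) (coneGen F H f)) := by
  intro x
  obtain ⟨v, w, rfl⟩ : ∃ v w, x = Sum.elim v w := ⟨_, _, (Sum.elim_comp_inl_inr x).symm⟩
  rw [linearCombination_coneGen]
  have hFI : ∀ v, Fintype.linearCombination (MvPolynomial (Fin n) k) F.gen v ∈ I := by
    intro v
    rw [Fintype.linearCombination_apply]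
    exact Ideal.sum_mem _ fun j _ => I.mul_mem_left _ (F.gen_mem j)
  constructor
  · intro h
    -- In a relation the coefficient of `f` multiplies `f` into `I`, so it lies in `K` and lifts to
    -- `H₀`.
    obtain ⟨y, hy⟩ := H.exists_augD_zero_mulVec_eq (w := w)
      (hK _ (by rw [← neg_eq_of_add_eq_zero_right h]; exact I.neg_mem (hFI v)))
    obtain ⟨u, hu⟩ := (F.exact_zero (v + (Φ.φ 0).mulVec y)).1 (by
      rw [map_add, Φ.comm_zero, hy, h])
    rw [Matrix.mulVecLin_apply] at hu
    refine ⟨Sum.elim u (-y), ?_⟩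
    rw [Matrix.mulVecLin_apply, coneD_mulVec_elim, Matrix.mulVec_neg, Matrix.mulVec_neg, neg_neg,
      hu, hy, add_neg_cancel_right]
  · rintro ⟨y, hy⟩
    obtain ⟨u, z, rfl⟩ : ∃ u z, y = Sum.elim u z := ⟨_, _, (Sum.elim_comp_inl_inr y).symm⟩
    rw [Matrix.mulVecLin_apply, coneD_mulVec_elim] at hy
    have hv : (F.d 0).mulVec u + (Φ.φ 0).mulVec z = v :=
      funext fun i => congrFun hy (Sum.inl i)
    have hw : -(H.augD 0).mulVec z = w := funext fun i => congrFun hy (Sum.inr i)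
    have h1 : Fintype.linearCombination (MvPolynomial (Fin n) k) F.gen ((F.d 0).mulVec u) = 0 :=
      F.exact_zero.apply_apply_eq_zero u
    rw [← hv, ← hw, map_add, h1, Φ.comm_zero, Pi.neg_apply, zero_add, neg_mul,
      add_neg_cancel]

/-- The mapping cone, a resolution of `(I, f)`. -/
def cone (hf : f.IsHomogeneous d) (hK : ∀ x, x * f ∈ I → x ∈ K) :
    GradedFreeResolution (I ⊔ Ideal.span {f}) where
  ι s := F.ι s ⊕ H.augι s
  fin _ := inferInstance
  deg s := Sum.elim (F.deg s) (H.augDeg d s)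
  gen := coneGen F H f
  d := Φ.coneD
  gen_homogeneous := by
    rintro (j | j)
    exacts [F.gen_homogeneous j, hf]
  d_homogeneous := by
    rintro s (i | i) (j | j) m hm
    · exact F.d_homogeneous s i j m hm
    · exact Φ.homogeneous s j i m hm
    · simp [coneD] at hm
    · rw [coneD, Matrix.fromBlocks_apply₂₂, Matrix.neg_apply, support_neg] at hm
      exact H.isHomogeneousVec_col_augD d s j i m hm
  span_gen := by
    rw [coneGen, Set.Sum.elim_range, Ideal.span_union, F.span_gen]
    congr 2
    exact Set.range_const (ι := Unit)
  exact_zero := Φ.exact_coneD_zero hK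
  exact_succ := Φ.exact_coneD

end ConeMap

/-! ### Linear resolutions of ideals of variables, and `Tor` of the cone. -/

/-- The resolution of the zero ideal by zero modules. -/
def zeroResolution : GradedFreeResolution (⊥ : Ideal (MvPolynomial (Fin n) k)) where
  ι _ := Empty
  fin _ := inferInstance
  deg _ _ := 0
  gen _ := 0
  d _ _ _ := 0
  gen_homogeneous j := j.elim
  d_homogeneous _ i := i.elim
  span_gen := by simp
  exact_zero v := ⟨fun _ => ⟨0, Subsingleton.elim _ _⟩, fun _ => by
    rw [Subsingleton.elim v 0, map_zero]⟩
  exact_succ _ v := ⟨fun _ => ⟨0, Subsingleton.elim _ _⟩, fun _ => Subsingleton.elim _ _⟩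

/-- The ideal generated by a set of variables has a linear resolution. -/
lemma exists_linear_resolution_span_X (V : Set (Fin n)) :
    ∃ H : GradedFreeResolution (Ideal.span (X '' V : Set (MvPolynomial (Fin n) k))),
      ∀ s j, H.deg s j = 1 + s := by
  induction V, V.toFinite using Set.Finite.induction_on with
  | empty =>
    rw [Set.image_empty, Ideal.span_empty]
    exact ⟨zeroResolution, fun s j => Empty.elim j⟩
  | @insert x V hx _ ih =>
    obtain ⟨H, hH⟩ := ih
    have hX : (X x : MvPolynomial (Fin n) k).IsHomogeneous 1 := isHomogeneous_X k x
    -- Here both ideals are `(V)`: since `x ∉ V`, the variable is regular modulo `(V)` and `(V) : x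
    -- = (V)`.
    obtain ⟨Φ⟩ := nonempty_coneMap H H hX fun y hy => Ideal.mul_mem_right _ _ hy
    have h : Ideal.span (X '' insert x V : Set (MvPolynomial (Fin n) k)) =
        Ideal.span (X '' V) ⊔ Ideal.span {X x} := by
      rw [Set.image_insert_eq, Ideal.span_insert, sup_comm]
    rw [h]
    refine ⟨Φ.cone hX fun y hy => ?_, ?_⟩
    · rw [mem_ideal_span_X_image] at hy ⊢
      intro m hm
      obtain ⟨i, hi, hmi⟩ := hy (m + Finsupp.single x 1) (by
        rw [mem_support_iff, coeff_mul_X]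
        exact mem_support_iff.1 hm)
      refine ⟨i, hi, ?_⟩
      rwa [Finsupp.add_apply, Finsupp.single_eq_of_ne (by rintro rfl; exact hx hi),
        add_zero] at hmi
    · rintro s (j | j)
      · exact hH s j
      · exact H.augDeg_of_linear hH 1 s j

/-- In degree `e` the summand from `H` is zero, so a cycle of the cone lies in the subcomplex `F ⊗
k`; if it bounded there, it would bound in the cone. -/
lemma ConeMap.nontrivial_tor_of_nontrivial_tor_cone {F : GradedFreeResolution I}
    {H : GradedFreeResolution K} {f : MvPolynomial (Fin n) k} {d : ℕ} (Φ : ConeMap F H f d)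
    (hf : f.IsHomogeneous d) (hK : ∀ x, x * f ∈ I → x ∈ K) {s e : ℕ}
    (hdeg : ∀ j, H.augDeg d s j ≠ e) (h : Nontrivial ((Φ.cone hf hK).Tor s e)) :
    Nontrivial (F.Tor s e) := by
  have hD : ∀ s (v : F.ι (s + 1) → k), (Φ.cone hf hK).tensorD s (Sum.elim v 0) =
      Sum.elim (F.tensorD s v) 0 := by
    intro s v
    change ((Φ.coneD s).map constantCoeff).mulVec (Sum.elim v 0) = _
    rw [coneD, Matrix.fromBlocks_map, Matrix.fromBlocks_mulVec, Sum.elim_comp_inl,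
      Sum.elim_comp_inr, Matrix.mulVec_zero, add_zero, Matrix.mulVec_zero, add_zero]
    congr 1
    funext i
    simp [Matrix.mulVec, dotProduct]
  rw [nontrivial_tor_iff] at h ⊢
  obtain ⟨x, ⟨hx, hxe⟩, hxb⟩ := h
  obtain ⟨v, rfl⟩ : ∃ v : F.ι s → k, x = Sum.elim v 0 := by
    refine ⟨x ∘ Sum.inl, funext ?_⟩
    rintro (j | j)
    · rfl
    · exact hxe (Sum.inr j) (hdeg j)
  refine ⟨v, ⟨?_, fun j hj => hxe (Sum.inl j) hj⟩, ?_⟩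
  · cases s with
    | zero => trivial
    | succ s =>
      change (Φ.cone hf hK).tensorD s _ = 0 at hx
      rw [hD] at hx
      exact funext fun i => congrFun hx (Sum.inl i)
  · rintro ⟨w, rfl⟩
    exact hxb ⟨Sum.elim w 0, hD s w⟩

end GradedFreeResolution

open GradedFreeResolution in
lemma satisfiesN_sup_of_isShellingMove {k : Type*} [Field k] {n d p : ℕ}
    {I : Ideal (MvPolynomial (Fin n) k)} {f : MvPolynomial (Fin n) k} (hf : f.IsHomogeneous d)
    (hN : SatisfiesN d p I) (hS : IsShellingMove I f) :
    SatisfiesN d p (I ⊔ Ideal.span {f}) := by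
  obtain ⟨F, hF⟩ := hN
  obtain ⟨V, hV⟩ := hS
  have hH := exists_linear_resolution_span_X (k := k) V
  rw [← hV] at hH
  obtain ⟨H, hH⟩ := hH
  obtain ⟨Φ⟩ := nonempty_coneMap F H hf fun x hx => Submodule.mem_colon_singleton.1 hx
  refine ⟨Φ.cone hf fun x hx => Submodule.mem_colon_singleton.2 hx, fun s hs e he => ?_⟩
  by_contra hne
  -- If `e ≠ d + s`, the summand from `H` has no basis vector of degree `e`, so the class comes from
  -- `Tor` of `I`.
  refine hne (hF s hs e (Φ.nontrivial_tor_of_nontrivial_tor_cone hf _ (fun j hj => hne ?_) he))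
  rw [← hj, H.augDeg_of_linear hH]

end

theorem proposition5p5 {k : Type*} [Field k] {n : ℕ} (d : ℕ)
    (I : Ideal (MvPolynomial (Fin n) k)) (hI : IsMonomialGeneratedInDegree d I)
    (a : Fin n →₀ ℕ) (ha : a.degree = d) (hf : MvPolynomial.monomial a (1 : k) ∉ I) :
    (SatisfiesN d 2 (I ⊔ Ideal.span {MvPolynomial.monomial a (1 : k)}) →
      IsShellingMove I (MvPolynomial.monomial a (1 : k))) ∧
    (SatisfiesN d 2 I →
      (IsShellingMove I (MvPolynomial.monomial a (1 : k)) ↔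
        SatisfiesN d 2 (I ⊔ Ideal.span {MvPolynomial.monomial a (1 : k)}))) ∧
    (∀ p : ℕ, 2 ≤ p → SatisfiesN d p I →
      IsShellingMove I (MvPolynomial.monomial a (1 : k)) →
        SatisfiesN d p (I ⊔ Ideal.span {MvPolynomial.monomial a (1 : k)})) := by
  have h1 := isShellingMove_of_satisfiesN_sup hI ha hf
  have h3 : ∀ p, SatisfiesN d p I → IsShellingMove I (MvPolynomial.monomial a (1 : k)) →
      SatisfiesN d p (I ⊔ Ideal.span {MvPolynomial.monomial a (1 : k)}) := fun p =>
    satisfiesN_sup_of_isShellingMove (isHomogeneous_monomial 1 ha)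
  exact ⟨h1, fun h => ⟨h3 2 h, h1⟩, fun p _ => h3 p⟩
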